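/- Let $n\ge 0$, let $s_i=(i\ i+1)\in S_n$ for $1\le i\le n-1$, and let $\mathscr T_n$ be the set of standard Young tableaux with $n$ boxes labelled $1,\dots,n$. For $x\in S_n$ let $\tau(x)$ be the set of those $s_i$ with $s_ix<x$ in Bruhat order (the left descent set). For $Y\in\mathscr T_n$ let $\tau(Y)$ be the set of those $s_i$ for which $i+1$ lies in a row strictly below the row of $i$ in $Y$, and let $s_i\cdot Y$ be the (not necessarily standard) tableau obtained from $Y$ by exchanging the labels $i$ and $i+1$. For $\Omega\in\{S_n,\mathscr T_n\}$ and $|i-j|=1$ put $D^{\Omega}_{i,j}=\{z\in\Omega : s_i\in\tau(z),\ s_j\notin\tau(z)\}$. Let $f_{i,j}:D^{\Omega}_{i,j}\to D^{\Omega}_{j,i}$ be the map that sends a permutation $x$ to the unique one of $s_ix,\ s_jx$ that lies in $D^{S_n}_{j,i}$ (a dual Knuth move), respectively a tableau $Y$ to the unique one of $s_i\cdot Y,\ s_j\cdot Y$ that is a standard tableau in $D^{\mathscr T_n}_{j,i}$. For $z,z'$ each in $S_n$ or in $\mathscr T_n$ (possibly one in each), write $z\underset{0}{\approx}z'$ if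 $\tau(z)=\tau(z')$, and, for $k\ge 1$, $z\underset{k}{\approx}z'$ if $z\underset{k-1}{\approx}z'$ and $f_{i,j}(z)\underset{k-1}{\approx}f_{i,j}(z')$ for all $i,j$ with $|i-j|=1$ such that $z$ and $z'$ both lie in the corresponding sets $D_{i,j}$. Write $\tau_g(z)=\tau_g(z')$ ("$z$ and $z'$ have the same generalized $\tau$-invariant") if $z\underset{k}{\approx}z'$ for all $k\ge 0$. For $x\in S_n$ let $P(x)\in\mathscr T_n$ be the insertion (left) tableau of $x$ under the Robinson--Schensted correspondence, obtained by row-inserting the one-line notation of $x$ from left to right. **Theorem.** For every $x\in S_n$ we have $\tau_g(x)=\tau_g(P(x))$. In particular, for all $x,y\in S_n$, $$\tau_g(x)=\tau_g(y)\iff \tau_g(P(x))=\tau_g(P(y)).$$ -/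

import Mathlib

namespace GenTau

/-! ## Simple transpositions

`S_n` is `Equiv.Perm (Fin n)`; the element `k : Fin n` stands for the number `k + 1`.
A simple transposition is recorded by its index `i : Fin (n - 1)`. -/

/-- The smaller of the two values exchanged by the `i`-th simple transposition. -/
def lo {n : ℕ} (i : Fin (n - 1)) : Fin n := ⟨i.1, by omega⟩

/-- The larger of the two values exchanged by the `i`-th simple transposition. -/
def hi {n : ℕ} (i : Fin (n - 1)) : Fin n := ⟨i.1 + 1, by omega⟩

/-- The `i`-th simple transposition. -/
def s {n : ℕ} (i : Fin (n - 1)) : Equiv.Perm (Fin n) := Equiv.swap (lo i) (hi i)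

/-- The simple transpositions with indices `i` and `j` are adjacent. -/
def Adjacent {n : ℕ} (i j : Fin (n - 1)) : Prop := i.1 + 1 = j.1 ∨ j.1 + 1 = i.1

theorem Adjacent.symm {n : ℕ} {i j : Fin (n - 1)} (h : Adjacent i j) : Adjacent j i := Or.symm h

/-! ## Generalized τ-invariants on arbitrary sets -/

/-- A set `Ω` with a τ-invariant, that is, a map `τ` from `Ω` to sets of simple transpositions,
and maps `f_{i,j} : D_{i,j} → D_{j,i}` for adjacent `s_i`, `s_j`, where `D_{i,j}` is the set of the
elements with `s_i` in, and `s_j` not in, their τ-invariant. -/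
structure TauSystem (n : ℕ) (Ω : Type) where
  tau : Ω → Set (Fin (n - 1))
  f : ∀ i j : Fin (n - 1), Adjacent i j →
    {x : Ω // i ∈ tau x ∧ j ∉ tau x} → {x : Ω // j ∈ tau x ∧ i ∉ tau x}

/-- The set `D_{i,j}`. -/
def TauSystem.D {n : ℕ} {Ω : Type} (A : TauSystem n Ω) (i j : Fin (n - 1)) : Set Ω :=
  {x | i ∈ A.tau x ∧ j ∉ A.tau x}

/-- Equivalence to order `k` between an element of `Ω` and an element of `Ω'`. -/
def EquivToOrder {n : ℕ} {Ω Ω' : Type} (A : TauSystem n Ω) (B : TauSystem n Ω') :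
    ℕ → Ω → Ω' → Prop
  | 0, x, y => A.tau x = B.tau y
  | k + 1, x, y => EquivToOrder A B k x y ∧
      ∀ (i j : Fin (n - 1)) (h : Adjacent i j) (hx : x ∈ A.D i j) (hy : y ∈ B.D i j),
        EquivToOrder A B k (A.f i j h ⟨x, hx⟩).1 (B.f i j h ⟨y, hy⟩).1

/-- `τ_g(x) = τ_g(y)`: `x` and `y` have the same generalized τ-invariant. -/
def SameGenTau {n : ℕ} {Ω Ω' : Type} (A : TauSystem n Ω) (B : TauSystem n Ω')
    (x : Ω) (y : Ω') : Prop :=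
  ∀ k : ℕ, EquivToOrder A B k x y

/-! ## Elementary facts on simple transpositions -/

theorem lo_lt_hi {n : ℕ} (i : Fin (n - 1)) : lo i < hi i := by
  simp [lo, hi, Fin.lt_def]

theorem s_lo {n : ℕ} (i : Fin (n - 1)) : s i (lo i) = hi i := Equiv.swap_apply_left _ _

theorem s_hi {n : ℕ} (i : Fin (n - 1)) : s i (hi i) = lo i := Equiv.swap_apply_right _ _

theorem s_s {n : ℕ} (i : Fin (n - 1)) (a : Fin n) : s i (s i a) = a :=
  Equiv.swap_apply_self _ _ _

theorem s_of_ne {n : ℕ} (i : Fin (n - 1)) (a : Fin n) (h1 : a.1 ≠ i.1) (h2 : a.1 ≠ i.1 + 1) :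
    s i a = a := by
  apply Equiv.swap_apply_of_ne_of_ne <;> · rw [Ne, Fin.ext_iff]; assumption

theorem s_val {n : ℕ} (i : Fin (n - 1)) (a : Fin n) :
    (s i a).1 = if a.1 = i.1 then i.1 + 1 else if a.1 = i.1 + 1 then i.1 else a.1 := by
  unfold s
  rw [Equiv.swap_apply_def]
  simp only [Fin.ext_iff, lo, hi]
  split_ifs <;> simp

theorem s_mul_s {n : ℕ} (i : Fin (n - 1)) : (s i * s i : Equiv.Perm (Fin n)) = 1 :=
  Equiv.swap_mul_self _ _

theorem s_inv {n : ℕ} (i : Fin (n - 1)) : (s i)⁻¹ = (s i : Equiv.Perm (Fin n)) :=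
  Equiv.swap_inv _ _

/-- A simple transposition preserves the order of every pair but the one it exchanges. -/
theorem s_lt {n : ℕ} (i : Fin (n - 1)) (a b : Fin n) (h : a < b) (h' : ¬ (a = lo i ∧ b = hi i)) :
    s i a < s i b := by
  rw [Fin.lt_def] at *
  rw [s_val, s_val]
  simp only [Fin.ext_iff, lo, hi] at h'
  split_ifs <;> omega

/-! ## Bruhat order and the τ-invariant of a permutation -/

/-- The product `s_{i_1} ⋯ s_{i_k}` of a word in the simple transpositions. -/
def wordProd {n : ℕ} (L : List (Fin (n - 1))) : Equiv.Perm (Fin n) := (L.map s).prod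

/-- The word `L` is a minimal-length expression for its product. -/
def IsReducedWord {n : ℕ} (L : List (Fin (n - 1))) : Prop :=
  ∀ L' : List (Fin (n - 1)), wordProd L' = wordProd L → L.length ≤ L'.length

/-- Bruhat order: `x` is the product of a (not necessarily connected) subword of a
minimal-length expression for `y`. -/
def BruhatLE {n : ℕ} (x y : Equiv.Perm (Fin n)) : Prop :=
  ∃ L L' : List (Fin (n - 1)), IsReducedWord L ∧ wordProd L = y ∧ L'.Sublist L ∧ wordProd L' = x

/-- Strict Bruhat order. -/
def BruhatLT {n : ℕ} (x y : Equiv.Perm (Fin n)) : Prop := BruhatLE x y ∧ x ≠ y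

/-- The τ-invariant (left descent set) of a permutation: the `s_i` with `s_i x < x`. -/
def permTau {n : ℕ} (x : Equiv.Perm (Fin n)) : Set (Fin (n - 1)) := {i | BruhatLT (s i * x) x}

theorem wordProd_cons {n : ℕ} (i : Fin (n - 1)) (L : List (Fin (n - 1))) :
    wordProd (i :: L) = s i * wordProd L := by simp [wordProd]

theorem exists_word {n : ℕ} (x : Equiv.Perm (Fin n)) : ∃ L, wordProd L = x := by
  rcases n with _ | m
  · exact ⟨[], Subsingleton.elim _ _⟩
  · have hx : x ∈ Submonoid.closure (Set.range fun i : Fin m ↦ Equiv.swap i.castSucc i.succ) := by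
      rw [Equiv.Perm.mclosure_swap_castSucc_succ]; trivial
    induction hx using Submonoid.closure_induction with
    | mem y hy =>
      obtain ⟨i, rfl⟩ := hy
      exact ⟨[i], by simp [wordProd, s, lo, hi]; rfl⟩
    | one => exact ⟨[], by simp [wordProd]⟩
    | mul y z _ _ hy hz =>
      obtain ⟨L, hL⟩ := hy
      obtain ⟨M, hM⟩ := hz
      exact ⟨L ++ M, by rw [← hL, ← hM]; simp [wordProd]⟩

theorem exists_reduced {n : ℕ} (x : Equiv.Perm (Fin n)) :
    ∃ L, IsReducedWord L ∧ wordProd L = x := by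
  classical
  have h : ∃ k, ∃ L : List (Fin (n - 1)), L.length = k ∧ wordProd L = x := by
    obtain ⟨L, hL⟩ := exists_word x
    exact ⟨_, L, rfl, hL⟩
  obtain ⟨L, hk, hL⟩ := Nat.find_spec h
  refine ⟨L, fun L' hL' => ?_, hL⟩
  rw [hk]
  exact Nat.find_min' h ⟨L', rfl, hL'.trans hL⟩

theorem exchange {n : ℕ} (L : List (Fin (n - 1))) (a b : Fin n) (hab : a < b)
    (h : (wordProd L)⁻¹ b < (wordProd L)⁻¹ a) :
    ∃ L' : List (Fin (n - 1)), L'.length + 1 = L.length ∧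
      wordProd L' = Equiv.swap a b * wordProd L := by
  induction L generalizing a b with
  | nil => simp [wordProd] at h; exact absurd h (not_lt.2 hab.le)
  | cons c L ih =>
    rw [wordProd_cons] at h ⊢
    by_cases hc : a = lo c ∧ b = hi c
    · refine ⟨L, rfl, ?_⟩
      rw [hc.1, hc.2, ← mul_assoc]
      change _ = s c * s c * _
      rw [s_mul_s, one_mul]
    · have h1 := s_lt c a b hab hc
      rw [mul_inv_rev, s_inv] at h
      obtain ⟨M, hM, hM'⟩ := ih _ _ h1 h
      refine ⟨c :: M, by simp [hM], ?_⟩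
      rw [wordProd_cons, hM', ← mul_assoc, ← mul_assoc, Equiv.mul_swap_eq_swap_mul, s_s, s_s]

/-- `s_i` is a left descent of `x` iff `i + 1` stands to the left of `i` in one-line notation. -/
theorem mem_permTau {n : ℕ} (x : Equiv.Perm (Fin n)) (i : Fin (n - 1)) :
    i ∈ permTau x ↔ x⁻¹ (hi i) < x⁻¹ (lo i) := by
  have key : ∀ y : Equiv.Perm (Fin n), y⁻¹ (hi i) < y⁻¹ (lo i) →
      ∀ L, IsReducedWord L → wordProd L = s i * y → IsReducedWord (i :: L) := by
    intro y hy L hL hLy M hM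
    rw [wordProd_cons, hLy, ← mul_assoc, s_mul_s, one_mul] at hM
    subst hM
    obtain ⟨M', h1, h2⟩ := exchange M _ _ (lo_lt_hi i) hy
    have := hL M' (h2.trans hLy.symm)
    simp; omega
  constructor
  · rintro ⟨⟨L, L', hL, hLx, hsub, hL'⟩, -⟩
    by_contra hlt
    have hlt' : x⁻¹ (lo i) < x⁻¹ (hi i) := by
      refine lt_of_le_of_ne (not_lt.1 hlt) fun h => ?_
      exact (lo_lt_hi i).ne (x⁻¹.injective h)
    have := key (s i * x) (by
      rw [mul_inv_rev, s_inv]; simpa [s_lo, s_hi] using hlt') L hL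
        (by rw [← mul_assoc, s_mul_s, one_mul, hLx])
    have := this L' (by rw [hL', wordProd_cons, hLx])
    have := hsub.length_le
    simp at *; omega
  · intro h
    obtain ⟨L, hL, hLx⟩ := exists_reduced (s i * x)
    refine ⟨⟨i :: L, L, key x h L hL hLx, ?_, List.sublist_cons_self _ _, hLx⟩, ?_⟩
    · rw [wordProd_cons, hLx, ← mul_assoc, s_mul_s, one_mul]
    · intro h
      have h2 : s i = 1 := mul_eq_right.1 h
      have h3 := s_lo i
      rw [h2] at h3
      exact (lo_lt_hi i).ne h3

/-- For `x ∈ D_{i,j}` exactly one of `s_i x` and `s_j x` lies in `D_{j,i}`. -/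
theorem perm_existsUnique {n : ℕ} {i j : Fin (n - 1)} (h : Adjacent i j)
    (x : Equiv.Perm (Fin n)) (hx : i ∈ permTau x ∧ j ∉ permTau x) :
    ∃! y : Equiv.Perm (Fin n), (y = s i * x ∨ y = s j * x) ∧ j ∈ permTau y ∧ i ∉ permTau y := by
  have conv : ∀ k l : Fin (n - 1), k ∈ permTau (s l * x) ↔
      (x⁻¹ (s l (hi k))).1 < (x⁻¹ (s l (lo k))).1 := by
    intro k l
    rw [mem_permTau, mul_inv_rev, s_inv]; rfl
  have inj : ∀ a b : Fin n, (x⁻¹ a).1 = (x⁻¹ b).1 → a.1 = b.1 := fun a b hab =>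
    congrArg Fin.val (x⁻¹.injective (Fin.ext hab))
  rw [mem_permTau, mem_permTau] at hx
  rcases h with h | h
  · have e1 : hi i = lo j := Fin.ext h
    have e2 : s i (hi j) = hi j := s_of_ne _ _ (by simp [hi]; omega) (by simp [hi]; omega)
    have e3 : s j (lo i) = lo i := s_of_ne _ _ (by simp [lo]; omega) (by simp [lo]; omega)
    have c1 := conv j i
    have c2 := conv i i
    have c3 := conv j j
    have c4 := conv i j
    rw [e2, ← e1, s_hi] at c1
    rw [s_lo, s_hi] at c2
    rw [s_lo, s_hi] at c3
    rw [e3, e1, s_lo] at c4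
    rw [e1] at c2 hx
    have i1 := inj (lo i) (lo j)
    have i2 := inj (lo j) (hi j)
    have i3 := inj (lo i) (hi j)
    have v1 : (lo i).1 = i.1 := rfl
    have v2 : (lo j).1 = j.1 := rfl
    have v3 : (hi j).1 = j.1 + 1 := rfl
    simp only [Fin.lt_def] at hx
    by_cases hc : (x⁻¹ (hi j)).1 < (x⁻¹ (lo i)).1
    · refine ⟨s i * x, ⟨Or.inl rfl, by rw [c1, c2]; omega⟩, ?_⟩
      rintro y ⟨rfl | rfl, hy⟩
      · rfl
      · rw [c3, c4] at hy; omega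
    · refine ⟨s j * x, ⟨Or.inr rfl, by rw [c3, c4]; omega⟩, ?_⟩
      rintro y ⟨rfl | rfl, hy⟩
      · rw [c1, c2] at hy; omega
      · rfl
  · have e1 : hi j = lo i := Fin.ext h
    have e2 : s i (lo j) = lo j := s_of_ne _ _ (by simp [lo]; omega) (by simp [lo]; omega)
    have e3 : s j (hi i) = hi i := s_of_ne _ _ (by simp [hi]; omega) (by simp [hi]; omega)
    have c1 := conv j i
    have c2 := conv i i
    have c3 := conv j j
    have c4 := conv i j
    rw [e2, e1, s_lo] at c1
    rw [s_lo, s_hi] at c2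
    rw [s_lo, s_hi] at c3
    rw [e3, ← e1, s_hi] at c4
    rw [e1] at c3 hx
    have i1 := inj (lo j) (lo i)
    have i2 := inj (lo i) (hi i)
    have i3 := inj (lo j) (hi i)
    have v1 : (lo i).1 = i.1 := rfl
    have v2 : (lo j).1 = j.1 := rfl
    have v3 : (hi i).1 = i.1 + 1 := rfl
    simp only [Fin.lt_def] at hx
    by_cases hc : (x⁻¹ (hi i)).1 < (x⁻¹ (lo j)).1
    · refine ⟨s i * x, ⟨Or.inl rfl, by rw [c1, c2]; omega⟩, ?_⟩
      rintro y ⟨rfl | rfl, hy⟩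
      · rfl
      · rw [c3, c4] at hy; omega
    · refine ⟨s j * x, ⟨Or.inr rfl, by rw [c3, c4]; omega⟩, ?_⟩
      rintro y ⟨rfl | rfl, hy⟩
      · rw [c1, c2] at hy; omega
      · rfl

/-- The τ-invariants of permutations, and the map `f_{i,j}` which sends `x ∈ D_{i,j}` to the
unique one of `s_i x`, `s_j x` that lies in `D_{j,i}`. -/
noncomputable def permSystem (n : ℕ) : TauSystem n (Equiv.Perm (Fin n)) where
  tau := permTau
  f _ _ h x := ⟨(perm_existsUnique h x.1 x.2).choose, (perm_existsUnique h x.1 x.2).choose_spec.1.2⟩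

/-! ## Standard Young tableaux -/

/-- A labelling of the boxes of a Young diagram with `n` boxes by the elements of `Fin n`
(standing for `1, …, n`), each used once: `box k` is the (row, column) of the box with label `k`. -/
@[ext] structure Tableau (n : ℕ) where
  shape : YoungDiagram
  box : Fin n → ℕ × ℕ
  bijOn : Set.BijOn box Set.univ (shape : Set (ℕ × ℕ))

/-- The labels increase strictly left-to-right in rows and top-to-bottom in columns. -/
def Tableau.IsStandard {n : ℕ} (Y : Tableau n) : Prop :=
  (∀ a b : Fin n, (Y.box a).1 = (Y.box b).1 → (Y.box a).2 < (Y.box b).2 → a < b) ∧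
  (∀ a b : Fin n, (Y.box a).2 = (Y.box b).2 → (Y.box a).1 < (Y.box b).1 → a < b)

/-- The set of standard Young tableaux with `n` boxes. -/
abbrev StdTableau (n : ℕ) : Type := {Y : Tableau n // Y.IsStandard}

/-- The tableau `s_i · Y`, in which the labels `i` and `i + 1` of `Y` are exchanged. -/
def Tableau.swapLabels {n : ℕ} (i : Fin (n - 1)) (Y : Tableau n) : Tableau n where
  shape := Y.shape
  box := Y.box ∘ s i
  bijOn := Y.bijOn.comp (Set.bijOn_univ.2 (s i).bijective)

/-- The τ-invariant of a tableau: the `s_i` such that `i + 1` is below the row of `i`. -/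
def tabTau {n : ℕ} (Y : StdTableau n) : Set (Fin (n - 1)) :=
  {i | (Y.1.box (lo i)).1 < (Y.1.box (hi i)).1}

theorem Tableau.box_inj {n : ℕ} (Y : Tableau n) {a b : Fin n} (h1 : (Y.box a).1 = (Y.box b).1)
    (h2 : (Y.box a).2 = (Y.box b).2) : a = b :=
  Y.bijOn.injOn (Set.mem_univ _) (Set.mem_univ _) (Prod.ext h1 h2)

theorem Tableau.exists_label {n : ℕ} (Y : Tableau n) (a : Fin n) (r c : ℕ)
    (hr : r ≤ (Y.box a).1) (hc : c ≤ (Y.box a).2) : ∃ d, (Y.box d).1 = r ∧ (Y.box d).2 = c := by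
  have h : (r, c) ∈ (Y.shape : Set (ℕ × ℕ)) :=
    Y.shape.isLowerSet (a := Y.box a) (Prod.mk_le_mk.2 ⟨hr, hc⟩ : (r, c) ≤ ((Y.box a).1, (Y.box a).2))
      (Y.bijOn.mapsTo (Set.mem_univ a))
  obtain ⟨d, -, hd⟩ := Y.bijOn.surjOn h
  exact ⟨d, by rw [hd], by rw [hd]⟩

theorem swapLabels_isStandard {n : ℕ} {Y : Tableau n} (hY : Y.IsStandard) (i : Fin (n - 1))
    (h1 : (Y.box (lo i)).1 ≠ (Y.box (hi i)).1) (h2 : (Y.box (lo i)).2 ≠ (Y.box (hi i)).2) :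
    (Y.swapLabels i).IsStandard := by
  have key : ∀ a b : Fin n, s i a < s i b → ((Y.box (s i a)).1 = (Y.box (s i b)).1 ∨
      (Y.box (s i a)).2 = (Y.box (s i b)).2) → a < b := by
    intro a b hab h
    have := s_lt i _ _ hab (by rintro ⟨ha, hb⟩; rw [ha, hb] at h; exact h.elim h1 h2)
    rwa [s_s, s_s] at this
  exact ⟨fun a b hr hc => key a b (hY.1 _ _ hr hc) (Or.inl hr),
    fun a b hr hc => key a b (hY.2 _ _ hr hc) (Or.inr hr)⟩

/-- For `Y ∈ D_{i,j}` exactly one of `s_i · Y` and `s_j · Y` is a standard tableau in `D_{j,i}`. -/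
theorem tab_existsUnique {n : ℕ} {i j : Fin (n - 1)} (h : Adjacent i j)
    (Y : StdTableau n) (hY : i ∈ tabTau Y ∧ j ∉ tabTau Y) :
    ∃! Z : StdTableau n, (Z.1 = Y.1.swapLabels i ∨ Z.1 = Y.1.swapLabels j) ∧
      j ∈ tabTau Z ∧ i ∉ tabTau Z := by
  obtain ⟨Y, std⟩ := Y
  have conv : ∀ (Z : StdTableau n) (k l : Fin (n - 1)), Z.1 = Y.swapLabels l →
      (k ∈ tabTau Z ↔ (Y.box (s l (lo k))).1 < (Y.box (s l (hi k))).1) := by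
    rintro ⟨Z, hZ⟩ k l rfl
    rfl
  simp only [tabTau, Set.mem_ofPred_eq] at hY
  rcases h with h | h
  · have e1 : hi i = lo j := Fin.ext h
    have e2 : s i (hi j) = hi j := s_of_ne _ _ (by simp [hi]; omega) (by simp [hi]; omega)
    have e3 : s j (lo i) = lo i := s_of_ne _ _ (by simp [lo]; omega) (by simp [lo]; omega)
    have c1 := fun Z => conv Z j i
    have c2 := fun Z => conv Z i i
    have c3 := fun Z => conv Z j j
    have c4 := fun Z => conv Z i j
    rw [e2, ← e1, s_hi] at c1
    rw [s_lo, s_hi] at c2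
    rw [s_lo, s_hi] at c3
    rw [e3, e1, s_lo] at c4
    rw [e1] at c2 hY
    have l1 : lo i < lo j := e1 ▸ lo_lt_hi i
    have l2 : lo j < hi j := lo_lt_hi j
    by_cases hc : (Y.box (lo i)).1 < (Y.box (hi j)).1
    · have hcol : (Y.box (lo i)).2 ≠ (Y.box (hi i)).2 := by
        rw [e1]
        intro hcol
        obtain ⟨d, d1, d2⟩ := Y.exists_label (lo j) (Y.box (hi j)).1 (Y.box (lo j)).2
          (by omega) le_rfl
        have k1 : lo i < d := std.2 _ _ (by omega) (by omega)
        have k2 : ¬ d < lo j := by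
          have := congrArg Fin.val e1
          simp only [Fin.lt_def, lo, hi] at *
          omega
        have k3 : (Y.box d).1 = (Y.box (lo j)).1 := by
          by_contra hne
          exact k2 (std.2 _ _ d2 (by omega))
        have k4 : (Y.box (lo j)).2 < (Y.box (hi j)).2 := by
          rcases lt_trichotomy (Y.box (lo j)).2 (Y.box (hi j)).2 with h | h | h
          · exact h
          · exact absurd (Y.box_inj (by omega) h) l2.ne
          · exact absurd (std.1 _ _ (by omega) h) (not_lt.2 l2.le)
        obtain ⟨d', d1', d2'⟩ := Y.exists_label (hi j) (Y.box (lo i)).1 (Y.box (hi j)).2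
          hc.le le_rfl
        have m1 : lo i < d' := std.1 _ _ d1'.symm (by omega)
        have m2 : d' < hi j := std.2 _ _ d2' (by omega)
        have m3 : d' = lo j := by
          simp only [Fin.lt_def, Fin.ext_iff, lo, hi] at *
          omega
        rw [m3] at d1'
        omega
      refine ⟨⟨_, swapLabels_isStandard std i (by rw [e1]; omega) hcol⟩,
        ⟨Or.inl rfl, by rw [c1 _ rfl, c2 _ rfl]; omega⟩, ?_⟩
      rintro Z ⟨hZ | hZ, hy⟩
      · exact Subtype.ext hZ
      · rw [c3 _ hZ, c4 _ hZ] at hy; omega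
    · have hcol : (Y.box (lo j)).2 ≠ (Y.box (hi j)).2 := by
        intro hcol
        exact absurd (std.2 _ _ hcol.symm (by omega)) (not_lt.2 l2.le)
      refine ⟨⟨_, swapLabels_isStandard std j (by omega) hcol⟩,
        ⟨Or.inr rfl, by rw [c3 _ rfl, c4 _ rfl]; omega⟩, ?_⟩
      rintro Z ⟨hZ | hZ, hy⟩
      · rw [c1 _ hZ, c2 _ hZ] at hy; omega
      · exact Subtype.ext hZ
  · have e1 : hi j = lo i := Fin.ext h
    have e2 : s i (lo j) = lo j := s_of_ne _ _ (by simp [lo]; omega) (by simp [lo]; omega)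
    have e3 : s j (hi i) = hi i := s_of_ne _ _ (by simp [hi]; omega) (by simp [hi]; omega)
    have c1 := fun Z => conv Z j i
    have c2 := fun Z => conv Z i i
    have c3 := fun Z => conv Z j j
    have c4 := fun Z => conv Z i j
    rw [e2, e1, s_lo] at c1
    rw [s_lo, s_hi] at c2
    rw [s_lo, s_hi] at c3
    rw [e3, ← e1, s_hi] at c4
    rw [e1] at c3 hY
    have l1 : lo j < lo i := e1 ▸ lo_lt_hi j
    have l2 : lo i < hi i := lo_lt_hi i
    by_cases hc : (Y.box (lo j)).1 < (Y.box (hi i)).1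
    · have hcol : (Y.box (lo i)).2 ≠ (Y.box (hi i)).2 := by
        intro hcol
        obtain ⟨d, d1, d2⟩ := Y.exists_label (hi i) (Y.box (lo j)).1 (Y.box (hi i)).2
          hc.le le_rfl
        have k1 : d < hi i := std.2 _ _ d2 (by omega)
        have k3 : (Y.box d).1 = (Y.box (lo i)).1 := by
          by_contra hne
          have := std.2 (lo i) d (by omega) (by omega)
          simp only [Fin.lt_def, lo, hi] at *
          omega
        have k4 : (Y.box (lo j)).2 < (Y.box (lo i)).2 := by
          rcases lt_trichotomy (Y.box (lo j)).2 (Y.box (lo i)).2 with h | h | h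
          · exact h
          · exact absurd (Y.box_inj (by omega) h) l1.ne
          · exact absurd (std.1 _ _ (by omega) h) (not_lt.2 l1.le)
        obtain ⟨d', d1', d2'⟩ := Y.exists_label (hi i) (Y.box (hi i)).1 (Y.box (lo j)).2
          le_rfl (by omega)
        have m1 : lo j < d' := std.2 _ _ d2'.symm (by omega)
        have m2 : d' < hi i := std.1 _ _ d1' (by omega)
        have m3 : d' = lo i := by
          simp only [Fin.lt_def, Fin.ext_iff, lo, hi] at *
          omega
        rw [m3] at d1'
        omega
      refine ⟨⟨_, swapLabels_isStandard std i (by omega) hcol⟩,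
        ⟨Or.inl rfl, by rw [c1 _ rfl, c2 _ rfl]; omega⟩, ?_⟩
      rintro Z ⟨hZ | hZ, hy⟩
      · exact Subtype.ext hZ
      · rw [c3 _ hZ, c4 _ hZ] at hy; omega
    · have hcol : (Y.box (lo j)).2 ≠ (Y.box (hi j)).2 := by
        rw [e1]
        intro hcol
        exact absurd (std.2 _ _ hcol.symm (by omega)) (not_lt.2 l1.le)
      refine ⟨⟨_, swapLabels_isStandard std j (by rw [e1]; omega) hcol⟩,
        ⟨Or.inr rfl, by rw [c3 _ rfl, c4 _ rfl]; omega⟩, ?_⟩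
      rintro Z ⟨hZ | hZ, hy⟩
      · rw [c1 _ hZ, c2 _ hZ] at hy; omega
      · exact Subtype.ext hZ

/-- The τ-invariants of standard tableaux, and the map `f_{i,j}` which sends `Y ∈ D_{i,j}` to the
unique one of `s_i · Y`, `s_j · Y` that is a standard tableau in `D_{j,i}`. -/
noncomputable def tabSystem (n : ℕ) : TauSystem n (StdTableau n) where
  tau := tabTau
  f _ _ h Y := ⟨(tab_existsUnique h Y.1 Y.2).choose, (tab_existsUnique h Y.1 Y.2).choose_spec.1.2⟩

/-! ## Robinson–Schensted insertion -/

/-- Insert `a` into a row: `a` replaces (bumps) the first entry greater than `a`, or is appended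
to the row if there is none. The second component is the bumped entry. -/
def rowInsert {n : ℕ} (a : Fin n) : List (Fin n) → List (Fin n) × Option (Fin n)
  | [] => ([a], none)
  | b :: r => if a < b then (a :: r, some b) else (b :: (rowInsert a r).1, (rowInsert a r).2)

/-- Insert `a` into the first row of a list of rows; a bumped entry is inserted into the next
row, and so on. -/
def insertRows {n : ℕ} (a : Fin n) : List (List (Fin n)) → List (List (Fin n))
  | [] => [[a]]
  | r :: rs =>
    match (rowInsert a r).2 with
    | none => (rowInsert a r).1 :: rs
    | some b => (rowInsert a r).1 :: insertRows b rs

/-- The rows of the insertion tableau of `x`: the entries of the one-line notation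
of `x` are inserted from left to right, starting from the empty tableau. -/
def insertionRows {n : ℕ} (x : Equiv.Perm (Fin n)) : List (List (Fin n)) :=
  (List.ofFn x).foldl (fun rs a => insertRows a rs) []

/-- The row `t` fits below the row `r`: it is not longer, and each of its entries is greater than
the entry above it. -/
def FitsBelow {n : ℕ} : List (Fin n) → List (Fin n) → Prop
  | _, [] => True
  | [], _ :: _ => False
  | a :: r, b :: t => a < b ∧ FitsBelow r t

theorem fitsBelow_nil {n : ℕ} (r : List (Fin n)) : FitsBelow r [] := by
  cases r <;> trivial

theorem FitsBelow.length_le {n : ℕ} {r t : List (Fin n)} (h : FitsBelow r t) :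
    t.length ≤ r.length := by
  induction r generalizing t with
  | nil => cases t with
    | nil => simp
    | cons b t => exact h.elim
  | cons a r ih => cases t with
    | nil => simp
    | cons b t => simpa using ih h.2

theorem FitsBelow.getElem_lt {n : ℕ} {r t : List (Fin n)} (h : FitsBelow r t) (k : ℕ)
    (hr : k < r.length) (ht : k < t.length) : r[k] < t[k] := by
  induction r generalizing t k with
  | nil => simp at hr
  | cons a r ih => cases t with
    | nil => simp at ht
    | cons b t => cases k with
      | zero => exact h.1
      | succ k => simpa using ih h.2 k (by simpa using hr) (by simpa using ht)

theorem FitsBelow.trans {n : ℕ} {r t u : List (Fin n)} (h : FitsBelow r t) (h' : FitsBelow t u) :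
    FitsBelow r u := by
  induction r generalizing t u with
  | nil => cases t with
    | nil => cases u with
      | nil => trivial
      | cons => exact h'.elim
    | cons => exact h.elim
  | cons a r ih => cases u with
    | nil => trivial
    | cons c u => cases t with
      | nil => exact h'.elim
      | cons b t => exact ⟨h.1.trans h'.1, ih h.2 h'.2⟩

theorem rowInsert_perm {n : ℕ} (a : Fin n) (r : List (Fin n)) :
    ((rowInsert a r).1 ++ (rowInsert a r).2.toList).Perm (a :: r) := by
  induction r with
  | nil => simp [rowInsert]
  | cons b r ih =>
    rw [rowInsert]
    split_ifs
    · simp only [Option.toList, List.cons_append, List.perm_cons]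
      exact List.perm_append_comm
    · exact (ih.cons b).trans (List.Perm.swap _ _ _)

theorem rowInsert_sorted {n : ℕ} (a : Fin n) (r : List (Fin n)) (hr : r.Pairwise (· < ·))
    (ha : a ∉ r) : (rowInsert a r).1.Pairwise (· < ·) := by
  induction r with
  | nil => simp [rowInsert]
  | cons b r ih =>
    rw [List.pairwise_cons] at hr
    rw [List.mem_cons, not_or] at ha
    rw [rowInsert]
    split_ifs with h
    · exact List.pairwise_cons.2 ⟨fun c hc => h.trans (hr.1 c hc), hr.2⟩
    · refine List.pairwise_cons.2 ⟨fun c hc => ?_, ih hr.2 ha.2⟩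
      have : c ∈ a :: r := (rowInsert_perm a r).subset (List.mem_append_left _ hc)
      rcases List.mem_cons.1 this with rfl | hc
      · exact lt_of_le_of_ne (not_lt.1 h) (Ne.symm ha.1)
      · exact hr.1 c hc

theorem FitsBelow.rowInsert {n : ℕ} (a : Fin n) {r t : List (Fin n)} (h : FitsBelow r t) :
    FitsBelow (rowInsert a r).1 t := by
  induction r generalizing t with
  | nil => cases t with
    | nil => trivial
    | cons => exact h.elim
  | cons b r ih => cases t with
    | nil => exact fitsBelow_nil _
    | cons c t =>
      rw [GenTau.rowInsert]
      split_ifs with hab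
      · exact ⟨hab.trans h.1, h.2⟩
      · exact ⟨h.1, ih h.2⟩

theorem rowInsert_bump {n : ℕ} (a b : Fin n) {r t : List (Fin n)} (hr : r.Pairwise (· < ·))
    (h : FitsBelow r t) (hb : (rowInsert a r).2 = some b) :
    FitsBelow (rowInsert a r).1 (rowInsert b t).1 := by
  induction r generalizing t with
  | nil => simp [rowInsert] at hb
  | cons c r ih =>
    rw [List.pairwise_cons] at hr
    rw [rowInsert] at hb ⊢
    split_ifs at hb ⊢ with hac
    · obtain rfl : c = b := by simpa using hb
      cases t with
      | nil => exact ⟨hac, fitsBelow_nil _⟩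
      | cons d t =>
        rw [rowInsert, if_pos h.1]
        exact ⟨hac, h.2⟩
    · have hcb : c < b := by
        apply hr.1
        have : b ∈ a :: r := (rowInsert_perm a r).subset (by
          apply List.mem_append_right; simp at hb; simp [hb])
        rcases List.mem_cons.1 this with rfl | hc
        · exfalso
          have key : ∀ r : List (Fin n), (rowInsert b r).2 ≠ some b := by
            intro r
            induction r with
            | nil => simp [rowInsert]
            | cons e r ihr =>
              rw [rowInsert]
              split_ifs with h
              · intro h'; simp at h'; exact h.ne h'.symm
              · exact ihr
          exact key r hb
        · exact hc
      cases t with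
      | nil => exact ⟨hcb, fitsBelow_nil _⟩
      | cons d t =>
        rw [rowInsert]
        split_ifs with hbd
        · exact ⟨hcb, h.2.rowInsert a⟩
        · exact ⟨h.1, ih hr.2 h.2 hb⟩

theorem insertRows_perm {n : ℕ} (a : Fin n) (rs : List (List (Fin n))) :
    (insertRows a rs).flatten.Perm (a :: rs.flatten) := by
  induction rs generalizing a with
  | nil => simp [insertRows]
  | cons r rs ih =>
    have h := rowInsert_perm a r
    rw [insertRows]
    split
    · next hn =>
      rw [hn] at h
      simpa using h.append_right rs.flatten
    · next b hb =>
      rw [hb] at h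
      simp only [List.flatten_cons]
      refine ((ih b).append_left _).trans ?_
      simpa using h.append_right rs.flatten

theorem insertRows_sorted {n : ℕ} (a : Fin n) (rs : List (List (Fin n)))
    (hs : ∀ r ∈ rs, r.Pairwise (· < ·)) (hn : (a :: rs.flatten).Nodup) :
    ∀ r ∈ insertRows a rs, r.Pairwise (· < ·) := by
  induction rs generalizing a with
  | nil => simp [insertRows]
  | cons r rs ih =>
    have ha : a ∉ r := fun h => (List.nodup_cons.1 hn).1 (by simp [h])
    have h1 := rowInsert_sorted a r (hs r (by simp)) ha
    rw [insertRows]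
    split
    · intro t ht
      rcases List.mem_cons.1 ht with rfl | ht
      · exact h1
      · exact hs t (by simp [ht])
    · next b hb =>
      intro t ht
      rcases List.mem_cons.1 ht with rfl | ht
      · exact h1
      · refine ih b (fun u hu => hs u (by simp [hu])) ?_ t ht
        have h := (rowInsert_perm a r).append_right rs.flatten
        rw [hb] at h
        have h2 : ((rowInsert a r).1 ++ (b :: rs.flatten)).Nodup := by
          have := h.nodup_iff.2 (by simpa using hn)
          simpa using this
        exact h2.of_append_right

theorem insertRows_chain {n : ℕ} (a : Fin n) (rs : List (List (Fin n)))
    (hs : ∀ r ∈ rs, r.Pairwise (· < ·)) (hc : rs.IsChain FitsBelow) :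
    (insertRows a rs).IsChain FitsBelow := by
  induction rs generalizing a with
  | nil => simp [insertRows]
  | cons r rs ih =>
    rw [insertRows]
    split
    · cases rs with
      | nil => simp
      | cons t rs =>
        rw [List.isChain_cons_cons] at hc ⊢
        exact ⟨hc.1.rowInsert a, hc.2⟩
    · next b hb =>
      cases rs with
      | nil =>
        have := rowInsert_bump a b (t := []) (hs r (by simp))
          (fitsBelow_nil r) hb
        simpa [insertRows, rowInsert] using this
      | cons t rs =>
        rw [List.isChain_cons_cons] at hc
        have h1 := rowInsert_bump a b (hs r (by simp)) hc.1 hb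
        have h2 := ih b (fun u hu => hs u (by simp [hu])) hc.2
        rw [insertRows] at h2 ⊢
        split at h2 <;> exact List.isChain_cons_cons.2 ⟨h1, h2⟩

/-- The rows of a standard tableau whose labels are the entries of `l`. -/
def IsStdRows {n : ℕ} (l : List (Fin n)) (rs : List (List (Fin n))) : Prop :=
  rs.flatten.Perm l ∧ (∀ r ∈ rs, r.Pairwise (· < ·)) ∧ rs.IsChain FitsBelow

theorem insertionRows_isStdRows {n : ℕ} (x : Equiv.Perm (Fin n)) :
    IsStdRows (List.ofFn x) (insertionRows x) := by
  have key : ∀ l : List (Fin n), l.Nodup →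
      IsStdRows l (l.foldl (fun rs a => insertRows a rs) []) := by
    intro l
    induction l using List.reverseRecOn with
    | nil => intro _; exact ⟨by simp, by simp, by simp⟩
    | append_singleton l a ih =>
      intro hl
      have hl' : (a :: l).Nodup := (List.perm_append_singleton a l).nodup_iff.1 hl
      obtain ⟨h1, h2, h3⟩ := ih (List.nodup_cons.1 hl').2
      rw [List.foldl_append]
      exact ⟨(insertRows_perm _ _).trans ((h1.cons a).trans (List.perm_append_singleton a l).symm),
        insertRows_sorted _ _ h2 ((h1.cons a).nodup_iff.2 hl'), insertRows_chain _ _ h2 h3⟩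
  exact key _ (List.nodup_ofFn.2 x.injective)

theorem findIdx_row {n : ℕ} {rs : List (List (Fin n))} (hn : rs.flatten.Nodup) (i j : ℕ)
    (hi : i < rs.length) (hj : j < rs[i].length) :
    rs.findIdx (fun r => decide (rs[i][j] ∈ r)) = i ∧ rs[i].idxOf rs[i][j] = j := by
  obtain ⟨h1, h2⟩ := List.nodup_flatten.1 hn
  refine ⟨?_, (h1 _ (List.getElem_mem hi)).idxOf_getElem _ hj⟩
  rw [List.findIdx_eq hi]
  refine ⟨by simp, fun k hk => ?_⟩
  have := List.pairwise_iff_getElem.1 h2 k i (by omega) hi hk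
  simpa using fun h => this h (List.getElem_mem hj)

theorem exists_getElem {n : ℕ} {rs : List (List (Fin n))} {k : Fin n} (hk : k ∈ rs.flatten) :
    ∃ (i j : ℕ) (hi : i < rs.length) (hj : j < rs[i].length), rs[i][j] = k := by
  obtain ⟨r, hr, hkr⟩ := List.mem_flatten.1 hk
  obtain ⟨i, hi, rfl⟩ := List.getElem_of_mem hr
  obtain ⟨j, hj, rfl⟩ := List.getElem_of_mem hkr
  exact ⟨i, j, hi, hj, rfl⟩

/-- The box (row, column) of the entry `k` in a list of rows. -/
def rowsBox {n : ℕ} (rs : List (List (Fin n))) (k : Fin n) : ℕ × ℕ :=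
  (rs.findIdx (fun r => decide (k ∈ r)),
    (rs.getD (rs.findIdx (fun r => decide (k ∈ r))) []).idxOf k)

theorem rowsBox_getElem {n : ℕ} {rs : List (List (Fin n))} (hn : rs.flatten.Nodup) (i j : ℕ)
    (hi : i < rs.length) (hj : j < rs[i].length) : rowsBox rs rs[i][j] = (i, j) := by
  obtain ⟨h1, h2⟩ := findIdx_row hn i j hi hj
  unfold rowsBox
  rw [h1, List.getD_eq_getElem _ _ hi, h2]

/-- The tableau with a given list of rows. -/
def tableauOfRows {n : ℕ} (rs : List (List (Fin n))) (hlen : (rs.map List.length).SortedGE)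
    (hn : rs.flatten.Nodup) (hall : ∀ k, k ∈ rs.flatten) : Tableau n where
  shape := YoungDiagram.ofRowLens (rs.map List.length) hlen
  box := rowsBox rs
  bijOn := by
    refine ⟨fun k _ => ?_, fun k _ l _ h => ?_, ?_⟩
    · obtain ⟨i, j, hi, hj, rfl⟩ := exists_getElem (hall k)
      rw [rowsBox_getElem hn, SetLike.mem_coe, YoungDiagram.mem_ofRowLens]
      exact ⟨by simpa using hi, by simpa using hj⟩
    · obtain ⟨i, j, hi, hj, rfl⟩ := exists_getElem (hall k)
      obtain ⟨i', j', hi', hj', rfl⟩ := exists_getElem (hall l)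
      rw [rowsBox_getElem hn, rowsBox_getElem hn] at h
      cases h
      rfl
    · rintro ⟨i, j⟩ h
      rw [SetLike.mem_coe, YoungDiagram.mem_ofRowLens] at h
      obtain ⟨hi, hj⟩ := h
      simp only [List.length_map] at hi
      simp only [List.getElem_map] at hj
      exact ⟨rs[i][j], Set.mem_univ _, rowsBox_getElem hn i j hi hj⟩

theorem IsStdRows.pairwise {n : ℕ} {l : List (Fin n)} {rs : List (List (Fin n))}
    (h : IsStdRows l rs) : rs.Pairwise FitsBelow :=
  haveI : Trans (@FitsBelow n) (@FitsBelow n) (@FitsBelow n) := ⟨FitsBelow.trans⟩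
  List.isChain_iff_pairwise.1 h.2.2

theorem IsStdRows.lengths {n : ℕ} {l : List (Fin n)} {rs : List (List (Fin n))}
    (h : IsStdRows l rs) : (rs.map List.length).SortedGE := by
  rw [List.sortedGE_iff_pairwise, List.pairwise_map]
  exact h.pairwise.imp fun h => h.length_le

theorem tableauOfRows_isStandard {n : ℕ} {l : List (Fin n)} {rs : List (List (Fin n))}
    (h : IsStdRows l rs) (hn : rs.flatten.Nodup) (hall : ∀ k, k ∈ rs.flatten) :
    (tableauOfRows rs h.lengths hn hall).IsStandard := by
  constructor
  · intro a b
    obtain ⟨i, j, hi, hj, rfl⟩ := exists_getElem (hall a)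
    obtain ⟨i', j', hi', hj', rfl⟩ := exists_getElem (hall b)
    change (rowsBox _ _).1 = (rowsBox _ _).1 → (rowsBox _ _).2 < (rowsBox _ _).2 → _
    rw [rowsBox_getElem hn, rowsBox_getElem hn]
    rintro rfl hlt
    exact List.pairwise_iff_getElem.1 (h.2.1 _ (List.getElem_mem hi)) j j' hj hj' hlt
  · intro a b
    obtain ⟨i, j, hi, hj, rfl⟩ := exists_getElem (hall a)
    obtain ⟨i', j', hi', hj', rfl⟩ := exists_getElem (hall b)
    change (rowsBox _ _).2 = (rowsBox _ _).2 → (rowsBox _ _).1 < (rowsBox _ _).1 → _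
    rw [rowsBox_getElem hn, rowsBox_getElem hn]
    rintro rfl hlt
    exact (List.pairwise_iff_getElem.1 h.pairwise i i' hi hi' hlt).getElem_lt j hj hj'

theorem insertionRows_nodup {n : ℕ} (x : Equiv.Perm (Fin n)) :
    (insertionRows x).flatten.Nodup :=
  (insertionRows_isStdRows x).1.nodup_iff.2 (List.nodup_ofFn.2 x.injective)

theorem mem_insertionRows {n : ℕ} (x : Equiv.Perm (Fin n)) (k : Fin n) :
    k ∈ (insertionRows x).flatten :=
  (insertionRows_isStdRows x).1.mem_iff.2 (List.mem_ofFn.2 (x.surjective k))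

/-- The insertion tableau (left tableau) `P(x)` of `x` under the Robinson–Schensted
correspondence. -/
def insertionTableau {n : ℕ} (x : Equiv.Perm (Fin n)) : StdTableau n :=
  ⟨tableauOfRows (insertionRows x) (insertionRows_isStdRows x).lengths (insertionRows_nodup x)
    (mem_insertionRows x), tableauOfRows_isStandard (insertionRows_isStdRows x) _ _⟩

end GenTau

/-! A permutation `x` is linked to its tableau `P(x)` by the reading word of `P(x)`: the entries
read row by row, bottom row first. Three facts carry the argument.

Every word is Knuth equivalent to the reading word of its insertion tableau
(`knuthEquiv_insertionRows`). A bump is a chain of Knuth transformations that carries the bumped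
letter to the left end of its row, which is the right end of the row below.

If `y` is the reading word of a standard tableau `Y`, then `y` and `Y` have the same τ-invariant,
and exchanging labels in `Y` exchanges the same letters in `y`. So a dual Knuth move of `Y` is a
dual Knuth move of `y`, and the result is again a reading word (`IsReadingWord.exists_isStar`).

Knuth equivalent permutations have the same τ-invariant, and `f_{i,j}` sends them to Knuth
equivalent permutations (`IsStar.knuthEquiv`). It suffices to check a single Knuth transformation.
Either both permutations use the same simple transposition, which then commutes with the
transformation, or the transformation exchanges two of the three letters that `f_{i,j}` looks at,
and the images again differ by a single Knuth transformation, of the other kind.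

Hence the relation "`x` is Knuth equivalent to a reading word of `Y`" forces equal τ-invariants and
is preserved by the maps `f_{i,j}`, so induction on the order `k` gives the first claim. The second
is formal, since having the same generalized τ-invariant is symmetric and transitive even across
different sets. -/

namespace GenTau

/-! ## Knuth equivalence of words -/

section Knuth

variable {α : Type*} [LinearOrder α]

/-- An elementary Knuth transformation: two neighbouring letters are exchanged next to a letter
that lies strictly between them. -/
inductive KnuthStep : List α → List α → Prop
  | left (u v : List α) {x y z : α} : x < y → y < z →
      KnuthStep (u ++ y :: x :: z :: v) (u ++ y :: z :: x :: v)
  | right (u v : List α) {x y z : α} : x < y → y < z →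
      KnuthStep (u ++ x :: z :: y :: v) (u ++ z :: x :: y :: v)

/-- Knuth equivalence of words. -/
abbrev KnuthEquiv : List α → List α → Prop := Relation.EqvGen KnuthStep

theorem KnuthStep.perm {w w' : List α} (h : KnuthStep w w') : w.Perm w' := by
  cases h with
  | left u v => exact List.Perm.append_left u ((List.Perm.swap _ _ _).cons _)
  | right u v => exact List.Perm.append_left u (List.Perm.swap _ _ _)

theorem KnuthStep.append {w w' : List α} (h : KnuthStep w w') (u v : List α) :
    KnuthStep (u ++ w ++ v) (u ++ w' ++ v) := by
  cases h with
  | left u' v' h1 h2 => simpa using KnuthStep.left (u ++ u') (v' ++ v) h1 h2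
  | right u' v' h1 h2 => simpa using KnuthStep.right (u ++ u') (v' ++ v) h1 h2

theorem KnuthEquiv.append {w w' : List α} (h : KnuthEquiv w w') (u v : List α) :
    KnuthEquiv (u ++ w ++ v) (u ++ w' ++ v) := by
  induction h with
  | rel _ _ h => exact .rel _ _ (h.append u v)
  | refl => exact .refl _
  | symm _ _ _ ih => exact .symm _ _ ih
  | trans _ _ _ _ _ ih1 ih2 => exact .trans _ _ _ ih1 ih2

theorem KnuthEquiv.cons {w w' : List α} (h : KnuthEquiv w w') (a : α) :
    KnuthEquiv (a :: w) (a :: w') := by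
  simpa using KnuthEquiv.append h [a] []

theorem KnuthEquiv.append_left {w w' : List α} (h : KnuthEquiv w w') (u : List α) :
    KnuthEquiv (u ++ w) (u ++ w') := by
  simpa using KnuthEquiv.append h u []

theorem KnuthEquiv.append_right {w w' : List α} (h : KnuthEquiv w w') (v : List α) :
    KnuthEquiv (w ++ v) (w' ++ v) := by
  simpa using KnuthEquiv.append h [] v

/-- The letter `a` travels left past the entries of `r` one at a time. When it passes `d`, the left
neighbour of `d` in the row lies strictly between `a` and `d` and so permits the exchange. -/
theorem knuthEquiv_cons_append_singleton {a c : α} (hac : a < c) (r : List α)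
    (hr : (c :: r).Pairwise (· < ·)) : KnuthEquiv (c :: (r ++ [a])) (c :: a :: r) := by
  induction r generalizing c with
  | nil => exact .refl _
  | cons d r ih =>
    obtain ⟨hc, hr⟩ := List.pairwise_cons.1 hr
    have hcd : c < d := hc d (by simp)
    exact .trans _ _ _ (KnuthEquiv.cons (ih (hac.trans hcd) hr) c)
      (.symm _ _ (.rel _ _ (KnuthStep.left [] r hac hcd)))

/-! ### Relative positions of letters under a Knuth transformation. -/

theorem idxOf_append_three (u v : List α) (A B C d : α) :
    (u ++ A :: B :: C :: v).idxOf d = if d ∈ u then u.idxOf d else if d = A then u.length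
      else if d = B then u.length + 1 else if d = C then u.length + 2
      else u.length + 3 + v.idxOf d := by
  simp only [List.idxOf_append, List.idxOf_cons, cond_eq_ite, beq_iff_eq, @eq_comm _ d]
  grind

theorem idxOf_lt_iff_left (u v : List α) {x y z d e : α} (hxz : x ≠ z)
    (k1 : ¬ (d = x ∧ e = z)) (k2 : ¬ (d = z ∧ e = x)) :
    (u ++ y :: x :: z :: v).idxOf d < (u ++ y :: x :: z :: v).idxOf e ↔
      (u ++ y :: z :: x :: v).idxOf d < (u ++ y :: z :: x :: v).idxOf e := by
  have h1 : d ∈ u → u.idxOf d < u.length := List.idxOf_lt_length_of_mem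
  have h2 : e ∈ u → u.idxOf e < u.length := List.idxOf_lt_length_of_mem
  simp only [idxOf_append_three]
  grind

theorem idxOf_lt_iff_right (u v : List α) {x y z d e : α} (hxz : x ≠ z)
    (k1 : ¬ (d = x ∧ e = z)) (k2 : ¬ (d = z ∧ e = x)) :
    (u ++ x :: z :: y :: v).idxOf d < (u ++ x :: z :: y :: v).idxOf e ↔
      (u ++ z :: x :: y :: v).idxOf d < (u ++ z :: x :: y :: v).idxOf e := by
  have h1 : d ∈ u → u.idxOf d < u.length := List.idxOf_lt_length_of_mem
  have h2 : e ∈ u → u.idxOf e < u.length := List.idxOf_lt_length_of_mem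
  simp only [idxOf_append_three]
  grind

/-- A Knuth transformation changes the relative position of no two letters but the two exchanged,
and some letter lies strictly between those. -/
theorem KnuthStep.idxOf_lt_iff {w w' : List α} (h : KnuthStep w w') {d e : α}
    (hde : ∀ y, ¬ (d < y ∧ y < e)) (hed : ∀ y, ¬ (e < y ∧ y < d)) :
    w.idxOf d < w.idxOf e ↔ w'.idxOf d < w'.idxOf e := by
  cases h with
  | @left u v x y z h1 h2 =>
    refine idxOf_lt_iff_left u v (h1.trans h2).ne ?_ ?_
    · rintro ⟨rfl, rfl⟩; exact hde y ⟨h1, h2⟩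
    · rintro ⟨rfl, rfl⟩; exact hed y ⟨h1, h2⟩
  | @right u v x y z h1 h2 =>
    refine idxOf_lt_iff_right u v (h1.trans h2).ne ?_ ?_
    · rintro ⟨rfl, rfl⟩; exact hde y ⟨h1, h2⟩
    · rintro ⟨rfl, rfl⟩; exact hed y ⟨h1, h2⟩

/-- If a Knuth transformation changes the relative position of `d` and `e`, and there is at most
one letter `b` with `d < b < e`, then it exchanges `d` and `e` next to `b`. -/
theorem KnuthStep.eq_of_exchange {w w' : List α} (h : KnuthStep w w') {d b e : α}
    (hde : d < e) (hb : ∀ y, d < y → y < e → y = b)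
    (hne : ¬ (w.idxOf d < w.idxOf e ↔ w'.idxOf d < w'.idxOf e)) :
    (∃ u v, w = u ++ b :: d :: e :: v ∧ w' = u ++ b :: e :: d :: v) ∨
    (∃ u v, w = u ++ d :: e :: b :: v ∧ w' = u ++ e :: d :: b :: v) := by
  cases h with
  | @left u v x y z h1 h2 =>
    have k2 : ¬ (d = z ∧ e = x) := by rintro ⟨rfl, rfl⟩; exact (h1.trans h2).not_gt hde
    have k : d = x ∧ e = z := by
      by_contra k1
      exact hne (idxOf_lt_iff_left u v (h1.trans h2).ne k1 k2)
    obtain ⟨rfl, rfl⟩ := k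
    obtain rfl := hb y h1 h2
    exact Or.inl ⟨u, v, rfl, rfl⟩
  | @right u v x y z h1 h2 =>
    have k2 : ¬ (d = z ∧ e = x) := by rintro ⟨rfl, rfl⟩; exact (h1.trans h2).not_gt hde
    have k : d = x ∧ e = z := by
      by_contra k1
      exact hne (idxOf_lt_iff_right u v (h1.trans h2).ne k1 k2)
    obtain ⟨rfl, rfl⟩ := k
    obtain rfl := hb y h1 h2
    exact Or.inr ⟨u, v, rfl, rfl⟩

/-- Both constructors of `KnuthStep` are directed: they turn an ascending neighbouring pair into a
descending one. A step therefore creates an inversion and never removes one. -/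
theorem KnuthStep.idxOf_lt_of_lt {w w' : List α} (h : KnuthStep w w') (hn : w.Nodup) {d e : α}
    (hde : d < e) (hw : w.idxOf e < w.idxOf d) : w'.idxOf e < w'.idxOf d := by
  cases h with
  | @left u v x y z h1 h2 =>
    have k1 : ¬ (e = x ∧ d = z) := by rintro ⟨rfl, rfl⟩; exact (h1.trans h2).not_gt hde
    refine (idxOf_lt_iff_left u v (h1.trans h2).ne k1 ?_).1 hw
    rintro ⟨rfl, rfl⟩
    simp only [List.nodup_append, List.nodup_cons, List.mem_cons, not_or] at hn
    simp only [idxOf_append_three] at hw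
    grind
  | @right u v x y z h1 h2 =>
    have k1 : ¬ (e = x ∧ d = z) := by rintro ⟨rfl, rfl⟩; exact (h1.trans h2).not_gt hde
    refine (idxOf_lt_iff_right u v (h1.trans h2).ne k1 ?_).1 hw
    rintro ⟨rfl, rfl⟩
    simp only [List.nodup_append, List.nodup_cons, List.mem_cons, not_or] at hn
    simp only [idxOf_append_three] at hw
    grind

/-- The letter `t` stands between the letters `d` and `e` in the word `w`. -/
def StandsBetween (w : List α) (t d e : α) : Prop :=
  (w.idxOf d < w.idxOf t ∧ w.idxOf t < w.idxOf e) ∨ (w.idxOf e < w.idxOf t ∧ w.idxOf t < w.idxOf d)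

theorem not_standsBetween_left {u v : List α} {A B C : α} (t : α)
    (hn : (u ++ A :: B :: C :: v).Nodup) :
    ¬ StandsBetween (u ++ A :: B :: C :: v) t A B := by
  have hu : t ∈ u → u.idxOf t < u.length := List.idxOf_lt_length_of_mem
  simp only [StandsBetween, idxOf_append_three]
  simp only [List.nodup_append, List.nodup_cons, List.mem_cons, not_or] at hn
  grind

theorem not_standsBetween_right {u v : List α} {A B C : α} (t : α)
    (hn : (u ++ A :: B :: C :: v).Nodup) :
    ¬ StandsBetween (u ++ A :: B :: C :: v) t B C := by
  have hu : t ∈ u → u.idxOf t < u.length := List.idxOf_lt_length_of_mem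
  simp only [StandsBetween, idxOf_append_three]
  simp only [List.nodup_append, List.nodup_cons, List.mem_cons, not_or] at hn
  grind

theorem StandsBetween.symm {w : List α} {t d e : α} (h : StandsBetween w t d e) :
    StandsBetween w t e d := Or.symm h

end Knuth

/-! ## Row insertion and Knuth equivalence -/

theorem rowInsert_none {n : ℕ} {a : Fin n} {r : List (Fin n)} (h : (rowInsert a r).2 = none) :
    (rowInsert a r).1 = r ++ [a] := by
  induction r with
  | nil => rfl
  | cons b r ih =>
    rw [rowInsert] at h ⊢
    split_ifs at h ⊢
    simpa using ih h

/-- The head `c` of the new row is the witness that later lets the bumped letter `b` move past the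
entry to the left of `c`. -/
theorem rowInsert_some {n : ℕ} {a b : Fin n} {r : List (Fin n)} (hr : r.Pairwise (· < ·))
    (h : (rowInsert a r).2 = some b) : ∃ c t, (rowInsert a r).1 = c :: t ∧ c < b := by
  induction r with
  | nil => simp [rowInsert] at h
  | cons d r ih =>
    rw [rowInsert] at h ⊢
    split_ifs at h ⊢ with had
    · obtain rfl : d = b := by simpa using h
      exact ⟨a, r, rfl, had⟩
    · obtain ⟨hd, hr⟩ := List.pairwise_cons.1 hr
      obtain ⟨c, t, hct, hcb⟩ := ih hr h
      refine ⟨d, _, rfl, ?_⟩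
      have hp := rowInsert_perm a r
      simp only at h
      rw [h] at hp
      rcases List.mem_cons.1 (hp.subset (by simp : b ∈ _)) with rfl | hb
      · have hc : c ∈ b :: r := hp.subset (by simp [hct])
        rcases List.mem_cons.1 hc with rfl | hc
        · exact absurd hcb (lt_irrefl _)
        · exact (hd c hc).trans hcb
      · exact hd b hb

/-- If `a` bumps the head of the row, it only has to travel left to the place after that head.
Otherwise the tail `r ++ [a]` becomes `b :: c :: t` by induction, and `d < c < b` lets `b` pass the
head `d`. -/
theorem knuthEquiv_rowInsert {n : ℕ} {a b : Fin n} {r : List (Fin n)} (hr : r.Pairwise (· < ·))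
    (ha : a ∉ r) (h : (rowInsert a r).2 = some b) :
    KnuthEquiv (r ++ [a]) (b :: (rowInsert a r).1) := by
  induction r with
  | nil => simp [rowInsert] at h
  | cons d r ih =>
    have hr' := hr
    rw [rowInsert] at h ⊢
    split_ifs at h ⊢ with had
    · obtain rfl : d = b := by simpa using h
      exact knuthEquiv_cons_append_singleton had r hr
    · obtain ⟨hd, hr⟩ := List.pairwise_cons.1 hr
      rw [List.mem_cons, not_or] at ha
      simp only at h
      obtain ⟨c, t, hct, hcb⟩ := rowInsert_some hr h
      have hdc : d < c := by
        have hc : c ∈ a :: r := (rowInsert_perm a r).subset (by simp [hct])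
        rcases List.mem_cons.1 hc with rfl | hc
        · exact lt_of_le_of_ne (not_lt.1 had) (Ne.symm ha.1)
        · exact hd c hc
      refine .trans _ _ _ (KnuthEquiv.cons (ih hr ha.2 h) d) ?_
      rw [hct]
      exact .rel _ _ (KnuthStep.right [] t hdc hcb)

/-- With the bottom row read first, a letter at the left end of one row is also at the right end of
the row below it, ready to be inserted there. -/
theorem knuthEquiv_insertRows {n : ℕ} (a : Fin n) (rs : List (List (Fin n)))
    (hs : ∀ r ∈ rs, r.Pairwise (· < ·)) (hn : (a :: rs.flatten).Nodup) :
    KnuthEquiv (rs.reverse.flatten ++ [a]) (insertRows a rs).reverse.flatten := by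
  induction rs generalizing a with
  | nil => exact .refl _
  | cons r rs ih =>
    have ha : a ∉ r := fun h => (List.nodup_cons.1 hn).1 (by simp [h])
    rw [insertRows]
    split
    · next h =>
      simp only [List.reverse_cons, List.flatten_append, List.flatten_singleton,
        rowInsert_none h, List.append_assoc]
      exact .refl _
    · next b h =>
      have hn' : (b :: rs.flatten).Nodup := by
        have hp := (rowInsert_perm a r).append_right rs.flatten
        rw [h] at hp
        have h2 : ((rowInsert a r).1 ++ (b :: rs.flatten)).Nodup := by
          simpa using hp.nodup_iff.2 (by simpa using hn)
        exact h2.of_append_right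
      have h1 := (knuthEquiv_rowInsert (hs r (by simp)) ha h).append_left rs.reverse.flatten
      have h2 := KnuthEquiv.append_right (ih b (fun u hu => hs u (by simp [hu])) hn')
        (rowInsert a r).1
      simp only [List.reverse_cons, List.flatten_append, List.flatten_singleton,
        List.append_assoc] at h1 h2 ⊢
      exact .trans _ _ _ h1 h2

theorem knuthEquiv_insertionRows {n : ℕ} (x : Equiv.Perm (Fin n)) :
    KnuthEquiv (List.ofFn x) (insertionRows x).reverse.flatten := by
  have key : ∀ l : List (Fin n), l.Nodup →
      IsStdRows l (l.foldl (fun rs a => insertRows a rs) []) ∧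
      KnuthEquiv l (l.foldl (fun rs a => insertRows a rs) []).reverse.flatten := by
    intro l
    induction l using List.reverseRecOn with
    | nil => intro _; exact ⟨⟨by simp, by simp, by simp⟩, .refl _⟩
    | append_singleton l a ih =>
      intro hl
      have hl' : (a :: l).Nodup := (List.perm_append_singleton a l).nodup_iff.1 hl
      obtain ⟨⟨h1, h2, h3⟩, h4⟩ := ih (List.nodup_cons.1 hl').2
      rw [List.foldl_append]
      have hn := (h1.cons a).nodup_iff.2 hl'
      exact ⟨⟨(insertRows_perm _ _).trans
          ((h1.cons a).trans (List.perm_append_singleton a l).symm),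
        insertRows_sorted _ _ h2 hn, insertRows_chain _ _ h2 h3⟩,
        .trans _ _ _ (h4.append_right [a]) (knuthEquiv_insertRows a _ h2 hn)⟩
  exact (key _ (List.nodup_ofFn.2 x.injective)).2

/-! ## Knuth equivalence and dual Knuth moves -/

theorem idxOf_ofFn {n : ℕ} (x : Equiv.Perm (Fin n)) (a : Fin n) :
    (List.ofFn x).idxOf a = (x⁻¹ a).1 := by
  have h := (List.nodup_ofFn.2 x.injective).idxOf_getElem (x⁻¹ a).1 (by simp)
  simpa using h

theorem ofFn_s_mul {n : ℕ} (i : Fin (n - 1)) (x : Equiv.Perm (Fin n)) :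
    List.ofFn (s i * x : Equiv.Perm (Fin n)) = (List.ofFn x).map (s i) := by
  rw [List.map_ofFn]; rfl

theorem exists_perm_of_perm_ofFn {n : ℕ} {x : Equiv.Perm (Fin n)} {l : List (Fin n)}
    (h : (List.ofFn x).Perm l) : ∃ y : Equiv.Perm (Fin n), List.ofFn y = l := by
  have hl : l.length = n := by simpa using h.length_eq.symm
  have hn : l.Nodup := h.nodup_iff.1 (List.nodup_ofFn.2 x.injective)
  have hinj : Function.Injective (fun k : Fin n => l[k.1]) := fun j k hjk =>
    Fin.ext ((hn.getElem_inj_iff).1 hjk)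
  refine ⟨Equiv.ofBijective _ (Finite.injective_iff_bijective.1 hinj), ?_⟩
  exact List.ext_getElem (by simp [hl]) (by simp)

theorem not_lt_and_lt_hi {n : ℕ} (i : Fin (n - 1)) (y : Fin n) : ¬ (lo i < y ∧ y < hi i) := by
  simp only [Fin.lt_def, lo, hi]; omega

/-- Left descents compare the positions of consecutive values, and a Knuth transformation never
exchanges consecutive values because some letter lies strictly between the two it exchanges. -/
theorem KnuthStep.permTau_eq {n : ℕ} {x y : Equiv.Perm (Fin n)}
    (h : KnuthStep (List.ofFn x) (List.ofFn y)) : permTau x = permTau y := by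
  ext i
  have := h.idxOf_lt_iff (d := hi i) (e := lo i)
    (fun z hz => (hz.1.trans hz.2).not_gt (lo_lt_hi i)) (not_lt_and_lt_hi i)
  rw [mem_permTau, mem_permTau]
  simpa only [idxOf_ofFn, Fin.lt_def] using this

/-- A Knuth transformation commutes with exchanging the letters `i` and `i + 1`, provided that some
letter stands between these. -/
theorem KnuthStep.map_s {n : ℕ} {w w' : List (Fin n)} (h : KnuthStep w w') (hn : w.Nodup)
    {i : Fin (n - 1)} {t t' : Fin n} (ht : StandsBetween w t (lo i) (hi i))
    (ht' : StandsBetween w' t' (lo i) (hi i)) : KnuthStep (w.map (s i)) (w'.map (s i)) := by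
  have hn' := h.perm.nodup_iff.1 hn
  cases h with
  | @left u v x y z h1 h2 =>
    simp only [List.map_append, List.map_cons]
    -- The transposition could spoil `x < y` or `y < z` only if that pair were `lo i`, `hi i`. But
    -- `x`, `y` are neighbours in `w` and `y`, `z` are neighbours in `w'`, where no letter can stand
    -- between them. This is why both words need a separating letter.
    refine .left _ _ (s_lt i _ _ h1 ?_) (s_lt i _ _ h2 ?_)
    · rintro ⟨rfl, rfl⟩
      exact not_standsBetween_left t hn ht.symm
    · rintro ⟨rfl, rfl⟩
      exact not_standsBetween_left t' hn' ht'
  | @right u v x y z h1 h2 =>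
    simp only [List.map_append, List.map_cons]
    refine .right _ _ (s_lt i _ _ h1 ?_) (s_lt i _ _ h2 ?_)
    · rintro ⟨rfl, rfl⟩
      exact not_standsBetween_right t' hn' ht'
    · rintro ⟨rfl, rfl⟩
      exact not_standsBetween_right t hn ht.symm

theorem map_s_of_not_mem {n : ℕ} (i : Fin (n - 1)) (u : List (Fin n)) (h1 : lo i ∉ u) (h2 : hi i ∉ u) :
    u.map (s i) = u := by
  conv_rhs => rw [← List.map_id u]
  refine List.map_congr_left fun a ha => Equiv.swap_apply_of_ne_of_ne ?_ ?_
  · rintro rfl; exact h1 ha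
  · rintro rfl; exact h2 ha

/-- The relation `x' = f_{i,j}(x)` on permutations, without the membership `x ∈ D_{i,j}`. -/
def IsStar {n : ℕ} (i j : Fin (n - 1)) (x x' : Equiv.Perm (Fin n)) : Prop :=
  (x' = s i * x ∨ x' = s j * x) ∧ j ∈ permTau x' ∧ i ∉ permTau x'

/-! ### Dual Knuth moves on three consecutive values. -/

theorem mem_permTau_s_mul {n : ℕ} (k l : Fin (n - 1)) (x : Equiv.Perm (Fin n)) :
    k ∈ permTau (s l * x) ↔ (x⁻¹ (s l (hi k))).1 < (x⁻¹ (s l (lo k))).1 := by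
  rw [mem_permTau, mul_inv_rev, s_inv]; rfl

theorem s_hi_of_succ {n : ℕ} {i j : Fin (n - 1)} (h : i.1 + 1 = j.1) : s i (hi j) = hi j :=
  s_of_ne _ _ (by simp [hi]; omega) (by simp [hi]; omega)

theorem s_lo_of_succ {n : ℕ} {i j : Fin (n - 1)} (h : i.1 + 1 = j.1) : s j (lo i) = lo i :=
  s_of_ne _ _ (by simp [lo]; omega) (by simp [lo]; omega)

/-- Write `a < b < c` for the values `lo i`, `lo j`, `hi j`. Membership in `D_{i,j}` says that `b`
precedes both others, so they occur in the order `b c a`, which `s i` turns into `a c b`, or `b a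
c`, which `s j` turns into `c a b`. In each case the third letter stands between the two exchanged.
-/
theorem IsStar.cases_up {n : ℕ} {i j : Fin (n - 1)} (h : i.1 + 1 = j.1)
    {x x' : Equiv.Perm (Fin n)} (hx : i ∈ permTau x ∧ j ∉ permTau x) (hs : IsStar i j x x') :
    (x' = s i * x ∧ (x⁻¹ (lo j)).1 < (x⁻¹ (hi j)).1 ∧ (x⁻¹ (hi j)).1 < (x⁻¹ (lo i)).1) ∨
    (x' = s j * x ∧ (x⁻¹ (lo j)).1 < (x⁻¹ (lo i)).1 ∧ (x⁻¹ (lo i)).1 < (x⁻¹ (hi j)).1) := by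
  have e1 : hi i = lo j := Fin.ext h
  have inj : ∀ a b : Fin n, a ≠ b → (x⁻¹ a).1 ≠ (x⁻¹ b).1 := fun a b hab h' =>
    hab (x⁻¹.injective (Fin.ext h'))
  have i1 := inj _ _ (lo_lt_hi j).ne
  have i2 := inj _ _ (lo_lt_hi i).ne
  have i3 := inj (lo i) (hi j) (by simp [lo, hi, Fin.ext_iff]; omega)
  rw [mem_permTau, mem_permTau, Fin.lt_def, Fin.lt_def] at hx
  obtain ⟨rfl | rfl, h1, h2⟩ := hs <;> rw [mem_permTau_s_mul] at h1 h2
  · rw [s_hi_of_succ h, ← e1, s_hi] at h1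
    rw [e1] at hx
    exact Or.inl ⟨rfl, by omega, h1⟩
  · rw [s_lo_of_succ h, e1, s_lo] at h2
    rw [e1] at hx i2
    exact Or.inr ⟨rfl, by omega, by omega⟩

/-- With `a < b < c` for `lo j`, `lo i`, `hi i`, now `b` comes last: `c a b` goes to `b a c` by `s
i`, and `a c b` goes to `b c a` by `s j`. -/
theorem IsStar.cases_down {n : ℕ} {i j : Fin (n - 1)} (h : j.1 + 1 = i.1)
    {x x' : Equiv.Perm (Fin n)} (hx : i ∈ permTau x ∧ j ∉ permTau x) (hs : IsStar i j x x') :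
    (x' = s i * x ∧ (x⁻¹ (hi i)).1 < (x⁻¹ (lo j)).1 ∧ (x⁻¹ (lo j)).1 < (x⁻¹ (lo i)).1) ∨
    (x' = s j * x ∧ (x⁻¹ (lo j)).1 < (x⁻¹ (hi i)).1 ∧ (x⁻¹ (hi i)).1 < (x⁻¹ (lo i)).1) := by
  have e1 : hi j = lo i := Fin.ext h
  have inj : ∀ a b : Fin n, a ≠ b → (x⁻¹ a).1 ≠ (x⁻¹ b).1 := fun a b hab h' =>
    hab (x⁻¹.injective (Fin.ext h'))
  have i1 := inj _ _ (lo_lt_hi j).ne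
  have i2 := inj _ _ (lo_lt_hi i).ne
  have i3 := inj (lo j) (hi i) (by simp [lo, hi, Fin.ext_iff]; omega)
  rw [mem_permTau, mem_permTau, Fin.lt_def, Fin.lt_def] at hx
  obtain ⟨rfl | rfl, h1, h2⟩ := hs <;> rw [mem_permTau_s_mul] at h1 h2
  · rw [s_lo_of_succ h, e1, s_lo] at h1
    rw [e1] at hx i1
    exact Or.inl ⟨rfl, by omega, by omega⟩
  · rw [s_hi_of_succ h, ← e1, s_hi] at h2
    rw [e1] at hx i1
    exact Or.inr ⟨rfl, by omega, by omega⟩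

theorem StandsBetween.of_ofFn {n : ℕ} {x : Equiv.Perm (Fin n)} {t d e : Fin n}
    (h : ((x⁻¹ d).1 < (x⁻¹ t).1 ∧ (x⁻¹ t).1 < (x⁻¹ e).1) ∨
      ((x⁻¹ e).1 < (x⁻¹ t).1 ∧ (x⁻¹ t).1 < (x⁻¹ d).1)) :
    StandsBetween (List.ofFn x) t d e := by
  simpa only [StandsBetween, idxOf_ofFn] using h

theorem map_s_append_three {n : ℕ} (i : Fin (n - 1)) (u v : List (Fin n)) (A B C : Fin n)
    (hn : (u ++ A :: B :: C :: v).Nodup) (hlo : lo i ∈ [A, B, C]) (hhi : hi i ∈ [A, B, C]) :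
    (u ++ A :: B :: C :: v).map (s i) = u ++ s i A :: s i B :: s i C :: v := by
  obtain ⟨-, hv, hd⟩ := List.nodup_append.1 hn
  have hv' : ∀ a ∈ [A, B, C], a ∉ v := by
    simp only [List.nodup_cons, List.mem_cons, not_or] at hv
    grind
  have hu : ∀ a ∈ [A, B, C], a ∉ u := fun a ha hau => hd a hau a (by
    rw [← List.singleton_append, ← List.singleton_append, ← List.singleton_append]
    simp only [List.mem_append, List.mem_cons] at ha ⊢
    grind) rfl
  simp only [List.map_append, List.map_cons]
  rw [map_s_of_not_mem i u (hu _ hlo) (hu _ hhi), map_s_of_not_mem i v (hv' _ hlo) (hv' _ hhi)]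

theorem lo_lt_hi_of_succ {n : ℕ} {i j : Fin (n - 1)} (h : i.1 + 1 = j.1) : lo i < hi j := by
  simp only [Fin.lt_def, lo, hi]; omega

theorem eq_lo_of_between {n : ℕ} {i j : Fin (n - 1)} (h : i.1 + 1 = j.1) (y : Fin n)
    (h1 : lo i < y) (h2 : y < hi j) : y = lo j := by
  simp only [Fin.lt_def, Fin.ext_iff, lo, hi] at *; omega

/-- The step must be `b a c → b c a` on three neighbouring letters. The two dual moves give `c a b`
and `a c b`, so a step of kind `left` becomes one of kind `right`, from the image of `w'` to that of
`w`. -/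
theorem KnuthStep.exchange_up {n : ℕ} {w w' : List (Fin n)} (h : KnuthStep w w') (hn : w.Nodup)
    {i j : Fin (n - 1)} (hij : i.1 + 1 = j.1)
    (h1 : w.idxOf (lo j) < w.idxOf (lo i)) (h2 : w.idxOf (lo i) < w.idxOf (hi j))
    (h3 : w'.idxOf (hi j) < w'.idxOf (lo i)) :
    KnuthStep (w'.map (s i)) (w.map (s j)) := by
  have hn' := h.perm.nodup_iff.1 hn
  have e1 : hi i = lo j := Fin.ext hij
  rcases h.eq_of_exchange (lo_lt_hi_of_succ hij) (eq_lo_of_between hij) (by omega) with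
    ⟨u, v, rfl, rfl⟩ | ⟨u, v, rfl, rfl⟩
  · rw [map_s_append_three j _ _ _ _ _ hn (by simp) (by simp),
      map_s_append_three i _ _ _ _ _ hn' (by simp) (by simp [e1]),
      s_lo, s_lo, s_hi, ← e1, s_hi, e1, s_hi_of_succ hij, s_lo_of_succ hij]
    exact .right u v (e1 ▸ lo_lt_hi i) (lo_lt_hi j)
  · have hu : lo i ∈ u → u.idxOf (lo i) < u.length := List.idxOf_lt_length_of_mem
    simp only [idxOf_append_three] at h1
    simp only [List.nodup_append, List.nodup_cons, List.mem_cons, not_or] at hn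
    grind

/-- The mirror case: the step is `a c b → c a b`, and the images are `b c a` and `b a c`. -/
theorem KnuthStep.exchange_down {n : ℕ} {w w' : List (Fin n)} (h : KnuthStep w w') (hn : w.Nodup)
    {i j : Fin (n - 1)} (hij : i.1 + 1 = j.1)
    (h1 : w.idxOf (hi j) < w.idxOf (lo j)) (h2 : w.idxOf (lo i) < w.idxOf (hi j))
    (h3 : w'.idxOf (hi j) < w'.idxOf (lo i)) :
    KnuthStep (w'.map (s j)) (w.map (s i)) := by
  have hn' := h.perm.nodup_iff.1 hn
  have e1 : hi i = lo j := Fin.ext hij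
  rcases h.eq_of_exchange (lo_lt_hi_of_succ hij) (eq_lo_of_between hij) (by omega) with
    ⟨u, v, rfl, rfl⟩ | ⟨u, v, rfl, rfl⟩
  · have hu : hi j ∈ u → u.idxOf (hi j) < u.length := List.idxOf_lt_length_of_mem
    simp only [idxOf_append_three] at h1
    simp only [List.nodup_append, List.nodup_cons, List.mem_cons, not_or] at hn
    grind
  · rw [map_s_append_three i _ _ _ _ _ hn (by simp) (by simp [e1]),
      map_s_append_three j _ _ _ _ _ hn' (by simp) (by simp),
      s_lo, s_lo, s_hi, ← e1, s_hi, e1, s_hi_of_succ hij, s_lo_of_succ hij]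
    exact .left u v (e1 ▸ lo_lt_hi i) (lo_lt_hi j)

/-- Dual Knuth moves commute with Knuth transformations. -/
theorem IsStar.knuthEquiv_of_step {n : ℕ} {i j : Fin (n - 1)} (hij : Adjacent i j)
    {x y x' y' : Equiv.Perm (Fin n)} (h : KnuthStep (List.ofFn x) (List.ofFn y))
    (hx : i ∈ permTau x ∧ j ∉ permTau x) (hx' : IsStar i j x x') (hy' : IsStar i j y y') :
    KnuthEquiv (List.ofFn x') (List.ofFn y') := by
  have hn : (List.ofFn x).Nodup := List.nodup_ofFn.2 x.injective
  have hy : i ∈ permTau y ∧ j ∉ permTau y := by rwa [← h.permTau_eq]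
  rcases hij with hij | hij
  · have e1 : hi i = lo j := Fin.ext hij
    rcases hx'.cases_up hij hx with ⟨rfl, h1, h2⟩ | ⟨rfl, h1, h2⟩ <;>
      rcases hy'.cases_up hij hy with ⟨rfl, h3, h4⟩ | ⟨rfl, h3, h4⟩ <;>
      simp only [ofFn_s_mul]
    · refine .rel _ _ (h.map_s hn (t := hi j) (t' := hi j) (.of_ofFn ?_) (.of_ofFn ?_)) <;>
        rw [e1] <;> omega
    -- This mixed case would require the step to undo the inversion of `lo i` and `hi j`, which a
    -- directed step cannot do.
    · have := h.idxOf_lt_of_lt hn (lo_lt_hi_of_succ hij) (by simpa only [idxOf_ofFn] using h2)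
      simp only [idxOf_ofFn] at this
      omega
    · exact .symm _ _ (.rel _ _ (h.exchange_up hn hij (by simpa only [idxOf_ofFn] using h1)
        (by simpa only [idxOf_ofFn] using h2) (by simpa only [idxOf_ofFn] using h4)))
    · exact .rel _ _ (h.map_s hn (t := lo i) (t' := lo i) (.of_ofFn (by omega))
        (.of_ofFn (by omega)))
  · have e1 : hi j = lo i := Fin.ext hij
    rcases hx'.cases_down hij hx with ⟨rfl, h1, h2⟩ | ⟨rfl, h1, h2⟩ <;>
      rcases hy'.cases_down hij hy with ⟨rfl, h3, h4⟩ | ⟨rfl, h3, h4⟩ <;>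
      simp only [ofFn_s_mul]
    · exact .rel _ _ (h.map_s hn (t := lo j) (t' := lo j) (.of_ofFn (by omega))
        (.of_ofFn (by omega)))
    · have := h.idxOf_lt_of_lt hn (lo_lt_hi_of_succ hij) (by simpa only [idxOf_ofFn] using h1)
      simp only [idxOf_ofFn] at this
      omega
    · exact .symm _ _ (.rel _ _ (h.exchange_down hn hij (by simpa only [idxOf_ofFn] using h2)
        (by simpa only [idxOf_ofFn] using h1) (by simpa only [idxOf_ofFn] using h3)))
    · refine .rel _ _ (h.map_s hn (t := hi i) (t' := hi i) (.of_ofFn ?_) (.of_ofFn ?_)) <;>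
        rw [e1] <;> omega

/-! ### From single Knuth transformations to Knuth equivalence. -/

theorem KnuthEquiv.perm {α : Type*} [LinearOrder α] {w w' : List α} (h : KnuthEquiv w w') :
    w.Perm w' := by
  induction h with
  | rel _ _ h => exact h.perm
  | refl => exact .refl _
  | symm _ _ _ ih => exact ih.symm
  | trans _ _ _ _ _ ih1 ih2 => exact ih1.trans ih2

/-- A property of pairs of permutations that is an equivalence relation and holds for Knuth
transformations holds for Knuth equivalent permutations. -/
theorem KnuthEquiv.perm_induction {n : ℕ} {r : Equiv.Perm (Fin n) → Equiv.Perm (Fin n) → Prop}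
    (hr : Equivalence r) (hs : ∀ x y : Equiv.Perm (Fin n),
      KnuthStep (List.ofFn x) (List.ofFn y) → r x y) {x y : Equiv.Perm (Fin n)}
    (h : KnuthEquiv (List.ofFn x) (List.ofFn y)) : r x y := by
  have inj : ∀ x y : Equiv.Perm (Fin n), List.ofFn x = List.ofFn y → x = y := fun x y h =>
    DFunLike.coe_injective (List.ofFn_injective h)
  generalize hw : List.ofFn x = w at h
  generalize hw' : List.ofFn y = w' at h
  induction h generalizing x y with
  | rel _ _ h => subst hw hw'; exact hs x y h
  | refl => rw [inj x y (hw.trans hw'.symm)]; exact hr.refl y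
  | symm _ _ _ ih => exact hr.symm (ih hw' hw)
  | trans _ _ _ h1 _ ih1 ih2 =>
    -- The intermediate word of a chain has the same letters, hence is the one-line notation of a
    -- permutation.
    obtain ⟨z, hz⟩ := exists_perm_of_perm_ofFn (hw ▸ KnuthEquiv.perm h1)
    exact hr.trans (ih1 hw hz) (ih2 hz hw')

theorem KnuthEquiv.permTau_eq {n : ℕ} {x y : Equiv.Perm (Fin n)}
    (h : KnuthEquiv (List.ofFn x) (List.ofFn y)) : permTau x = permTau y :=
  h.perm_induction (r := fun x y => permTau x = permTau y)
    ⟨fun _ => rfl, fun h => h.symm, fun h h' => h.trans h'⟩ fun _ _ h => h.permTau_eq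

theorem IsStar.eq {n : ℕ} {i j : Fin (n - 1)} (hij : Adjacent i j) {x x' x'' : Equiv.Perm (Fin n)}
    (hx : i ∈ permTau x ∧ j ∉ permTau x) (h' : IsStar i j x x') (h'' : IsStar i j x x'') :
    x' = x'' :=
  (perm_existsUnique hij x hx).unique h' h''

theorem IsStar.knuthEquiv {n : ℕ} {i j : Fin (n - 1)} (hij : Adjacent i j)
    {x y x' y' : Equiv.Perm (Fin n)} (h : KnuthEquiv (List.ofFn x) (List.ofFn y))
    (hx : i ∈ permTau x ∧ j ∉ permTau x) (hx' : IsStar i j x x') (hy' : IsStar i j y y') :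
    KnuthEquiv (List.ofFn x') (List.ofFn y') := by
  -- Equality of τ-invariants is built into the relation so that membership in `D_{i,j}` passes
  -- along the chain; symmetry and transitivity both need it.
  have key := h.perm_induction (r := fun x y => permTau x = permTau y ∧
    ((i ∈ permTau x ∧ j ∉ permTau x) → ∀ x' y', IsStar i j x x' → IsStar i j y y' →
      KnuthEquiv (List.ofFn x') (List.ofFn y')))
    ⟨fun x => ⟨rfl, fun hx x' y' hx' hy' => hx'.eq hij hx hy' ▸ .refl _⟩,
      fun ⟨h1, h2⟩ => ⟨h1.symm, fun hx x' y' hx' hy' =>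
        .symm _ _ (h2 (by rwa [h1]) y' x' hy' hx')⟩,
      fun {x y z} ⟨h1, h2⟩ ⟨h3, h4⟩ => ⟨h1.trans h3, fun hx x' z' hx' hz' => by
        have hy : i ∈ permTau y ∧ j ∉ permTau y := by rwa [← h1]
        obtain ⟨y', hy', -⟩ := perm_existsUnique hij y hy
        exact .trans _ _ _ (h2 hx x' y' hx' hy') (h4 hy y' z' hy' hz')⟩⟩
    fun x y h => ⟨h.permTau_eq, fun hx x' y' hx' hy' => hx'.knuthEquiv_of_step hij h hx hy'⟩
  exact key.2 hx x' y' hx' hy'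

/-! ## Reading words of tableaux -/

/-- The box `p` precedes the box `q` in the reading order: rows from bottom to top, each from left
to right. -/
def ReadsBefore (p q : ℕ × ℕ) : Prop := q.1 < p.1 ∨ (p.1 = q.1 ∧ p.2 < q.2)

theorem ReadsBefore.asymm {p q : ℕ × ℕ} (h : ReadsBefore p q) : ¬ ReadsBefore q p := by
  simp only [ReadsBefore] at *; omega

/-- The one-line notation of `x` is the reading word of `Y`. -/
def IsReadingWord {n : ℕ} (x : Equiv.Perm (Fin n)) (Y : Tableau n) : Prop :=
  ∀ p q : Fin n, p < q → ReadsBefore (Y.box (x p)) (Y.box (x q))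

/-- The labels change in the word and in the tableau alike, so the sequence of boxes visited is the
same. -/
theorem IsReadingWord.swapLabels {n : ℕ} {x : Equiv.Perm (Fin n)} {Y : Tableau n}
    (h : IsReadingWord x Y) (i : Fin (n - 1)) : IsReadingWord (s i * x) (Y.swapLabels i) := by
  intro p q hpq
  simpa [Tableau.swapLabels, s_s] using h p q hpq

/-- If `i + 1` is read before `i`, it is in a lower row or to the left of `i` in the same row;
standardness rules out the latter. -/
theorem IsReadingWord.tau_eq {n : ℕ} {x : Equiv.Perm (Fin n)} {Y : StdTableau n}
    (h : IsReadingWord x Y.1) : permTau x = tabTau Y := by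
  ext i
  rw [mem_permTau]
  have hlt := lo_lt_hi i
  have hinv : ∀ a, x (x⁻¹ a) = a := x.apply_symm_apply
  constructor
  · intro h1
    have h2 := h _ _ h1
    rw [hinv, hinv] at h2
    rcases h2 with h2 | ⟨h2, h3⟩
    · exact h2
    · exact absurd (Y.2.1 _ _ h2 h3) hlt.not_gt
  · intro h1
    by_contra h2
    have h3 : x⁻¹ (lo i) < x⁻¹ (hi i) :=
      lt_of_le_of_ne (not_lt.1 h2) fun h' => hlt.ne (x⁻¹.injective h')
    have h4 := h _ _ h3
    rw [hinv, hinv] at h4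
    exact h4.asymm (Or.inl h1)

theorem exists_isReadingWord {n : ℕ} (x : Equiv.Perm (Fin n)) :
    ∃ y : Equiv.Perm (Fin n), KnuthEquiv (List.ofFn x) (List.ofFn y) ∧
      IsReadingWord y (insertionTableau x).1 := by
  have h := knuthEquiv_insertionRows x
  obtain ⟨y, hy⟩ := exists_perm_of_perm_ofFn (KnuthEquiv.perm h)
  refine ⟨y, hy ▸ h, ?_⟩
  have hn := insertionRows_nodup x
  have hbox : ∀ (i j : ℕ) (hi : i < (insertionRows x).length) (hj : j < (insertionRows x)[i].length),
    (insertionTableau x).1.box (insertionRows x)[i][j] = (i, j) := rowsBox_getElem hn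
  have key : (List.ofFn y).Pairwise fun a b =>
      ReadsBefore ((insertionTableau x).1.box a) ((insertionTableau x).1.box b) := by
    rw [hy, List.pairwise_flatten, List.pairwise_reverse]
    constructor
    · intro r hr
      obtain ⟨i, hi, rfl⟩ := List.getElem_of_mem (List.mem_reverse.1 hr)
      refine List.pairwise_iff_getElem.2 fun j k hj hk hjk => ?_
      rw [hbox, hbox]
      exact Or.inr ⟨rfl, hjk⟩
    · refine List.pairwise_iff_getElem.2 fun i k hi hk hik a ha b hb => ?_
      obtain ⟨j, hj, rfl⟩ := List.getElem_of_mem ha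
      obtain ⟨l, hl, rfl⟩ := List.getElem_of_mem hb
      rw [hbox, hbox]
      exact Or.inl hik
  intro p q hpq
  exact List.pairwise_ofFn.1 key hpq

/-! ## Generalized τ-invariants -/

theorem permSystem_f {n : ℕ} {i j : Fin (n - 1)} (h : Adjacent i j)
    (x : {x : Equiv.Perm (Fin n) // i ∈ permTau x ∧ j ∉ permTau x}) :
    IsStar i j x.1 ((permSystem n).f i j h x).1 :=
  (perm_existsUnique h x.1 x.2).choose_spec.1

theorem tabSystem_f {n : ℕ} {i j : Fin (n - 1)} (h : Adjacent i j)
    (Y : {Y : StdTableau n // i ∈ tabTau Y ∧ j ∉ tabTau Y}) :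
    (((tabSystem n).f i j h Y).1.1 = Y.1.1.swapLabels i ∨
      ((tabSystem n).f i j h Y).1.1 = Y.1.1.swapLabels j) ∧
      j ∈ tabTau ((tabSystem n).f i j h Y).1 ∧ i ∉ tabTau ((tabSystem n).f i j h Y).1 :=
  (tab_existsUnique h Y.1 Y.2).choose_spec.1

/-- A dual Knuth move of a tableau is a dual Knuth move of its reading word. -/
theorem IsReadingWord.exists_isStar {n : ℕ} {i j : Fin (n - 1)} (h : Adjacent i j)
    {y : Equiv.Perm (Fin n)} (Y : {Y : StdTableau n // i ∈ tabTau Y ∧ j ∉ tabTau Y})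
    (hy : IsReadingWord y Y.1.1) :
    ∃ y', IsStar i j y y' ∧ IsReadingWord y' ((tabSystem n).f i j h Y).1.1 := by
  obtain ⟨h1, h2⟩ := tabSystem_f h Y
  rcases h1 with h1 | h1
  -- The choice made by the tableau decides the choice for the word: the new word reads the new
  -- tableau, so it inherits the τ-invariant that puts it in `D_{j,i}`.
  · have hr : IsReadingWord (s i * y) ((tabSystem n).f i j h Y).1.1 := h1 ▸ hy.swapLabels i
    exact ⟨s i * y, ⟨Or.inl rfl, by rwa [hr.tau_eq]⟩, hr⟩
  · have hr : IsReadingWord (s j * y) ((tabSystem n).f i j h Y).1.1 := h1 ▸ hy.swapLabels j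
    exact ⟨s j * y, ⟨Or.inr rfl, by rwa [hr.tau_eq]⟩, hr⟩

/-- The claim is made for an arbitrary standard tableau `Y`, not only for `P(x)`, so that the
induction needs no knowledge of how `P` behaves under `f_{i,j}`. -/
theorem equivToOrder_of_knuthEquiv {n : ℕ} (k : ℕ) {x y : Equiv.Perm (Fin n)} {Y : StdTableau n}
    (h : KnuthEquiv (List.ofFn x) (List.ofFn y)) (hy : IsReadingWord y Y.1) :
    EquivToOrder (permSystem n) (tabSystem n) k x Y := by
  induction k generalizing x y Y with
  | zero => exact (KnuthEquiv.permTau_eq h).trans hy.tau_eq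
  | succ k ih =>
    refine ⟨ih h hy, fun i j hij hx hY => ?_⟩
    obtain ⟨y', hy', hr⟩ := hy.exists_isStar hij ⟨Y, hY⟩
    exact ih (IsStar.knuthEquiv hij h hx (permSystem_f hij ⟨x, hx⟩) hy') hr

theorem sameGenTau_insertionTableau {n : ℕ} (x : Equiv.Perm (Fin n)) :
    SameGenTau (permSystem n) (tabSystem n) x (insertionTableau x) := fun k => by
  obtain ⟨y, h, hy⟩ := exists_isReadingWord x
  exact equivToOrder_of_knuthEquiv k h hy

/-! ### Symmetry and transitivity across different sets. -/

section

variable {n : ℕ} {Ω Ω' Ω'' : Type} {A : TauSystem n Ω} {B : TauSystem n Ω'} {C : TauSystem n Ω''}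

theorem EquivToOrder.tau_eq {k : ℕ} {x : Ω} {y : Ω'} (h : EquivToOrder A B k x y) :
    A.tau x = B.tau y := by
  induction k with
  | zero => exact h
  | succ k ih => exact ih h.1

theorem EquivToOrder.symm {k : ℕ} {x : Ω} {y : Ω'} (h : EquivToOrder A B k x y) :
    EquivToOrder B A k y x := by
  induction k generalizing x y with
  | zero => exact Eq.symm h
  | succ k ih => exact ⟨ih h.1, fun i j hij hy hx => ih (h.2 i j hij hx hy)⟩

theorem EquivToOrder.trans {k : ℕ} {x : Ω} {y : Ω'} {z : Ω''} (h : EquivToOrder A B k x y)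
    (h' : EquivToOrder B C k y z) : EquivToOrder A C k x z := by
  induction k generalizing x y z with
  | zero => exact Eq.trans h h'
  | succ k ih =>
    refine ⟨ih h.1 h'.1, fun i j hij hx hz => ?_⟩
    -- The definition constrains `f_{i,j}` only where both elements lie in `D_{i,j}`; equal
    -- τ-invariants place the middle element there too.
    have hy : y ∈ B.D i j := by
      have := h.tau_eq
      simpa [TauSystem.D, this] using hx
    exact ih (h.2 i j hij hx hy) (h'.2 i j hij hy hz)

theorem SameGenTau.symm {x : Ω} {y : Ω'} (h : SameGenTau A B x y) : SameGenTau B A y x :=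
  fun k => (h k).symm

theorem SameGenTau.trans {x : Ω} {y : Ω'} {z : Ω''} (h : SameGenTau A B x y)
    (h' : SameGenTau B C y z) : SameGenTau A C x z :=
  fun k => (h k).trans (h' k)

end

end GenTau

theorem mainTheorem7 (n : ℕ) :
    (∀ x : Equiv.Perm (Fin n),
      GenTau.SameGenTau (GenTau.permSystem n) (GenTau.tabSystem n) x
        (GenTau.insertionTableau x)) ∧
    (∀ x y : Equiv.Perm (Fin n),
      GenTau.SameGenTau (GenTau.permSystem n) (GenTau.permSystem n) x y ↔
        GenTau.SameGenTau (GenTau.tabSystem n) (GenTau.tabSystem n)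
          (GenTau.insertionTableau x) (GenTau.insertionTableau y)) := by
  have key := fun x : Equiv.Perm (Fin n) => GenTau.sameGenTau_insertionTableau x
  -- The invariants are compared along the chain `P(x)`, `x`, `y`, `P(y)`, and conversely along `x`,
  -- `P(x)`, `P(y)`, `y`.
  exact ⟨key, fun x y => ⟨fun h => ((key x).symm.trans h).trans (key y),
    fun h => ((key x).trans h).trans (key y).symm⟩⟩
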